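/- Let $H(p)=-p\log_2 p-(1-p)\log_2(1-p)$, let $p\in(0,1/2)$, $r\in[0,1-H(p))$, and let $c,s\ge 1$ be integers. A Boolean circuit is a finite acyclic directed graph whose nodes are input nodes (each carrying one of the input bits) and logic gates of in-degree two and unbounded fan-out (each computing an arbitrary Boolean function of two bits), with each output bit read off at some node; its size is its total number of nodes. For $n\ge1$ and $\rho\in[0,1]$ let $\mathrm{CKT}(\rho,cn^s)$ be the set of functions $f:\{0,1\}^n\to\{0,1\}^{\lfloor \rho n\rfloor}$ computed by some Boolean circuit of size at most $cn^s$. A code of rate $R\in(0,1]$ and blocklength $n$ consists of a deterministic encoder $\mathcal C_n:[M]\to\{0,1\}^n$, where $M=\lfloor 2^{Rn}\rfloor$ and $[M]=\{1,\dots,M\}$, and a deterministic decoder $\hat m:\{0,1\}^n\to[M]\cup\{\text{error}\}$. The message $m_0$ is uniform on $[M]$. For a set $F_n$ of functions $\{0,1\}^n\to\{0,1\}^{\lfloor \rho n\rfloor}$, the average probability of error of the code against an adversary who chooses $f\in F_n$ knowing the code, observes $\Psi=f(\mathcal C_n(m_0))$, and then adds an error vector $e\in\{0,1\}^n$ of Hamming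 weight at most $pn$, is $$\max_{f\in F_n}\ \sum_{\psi\in\{0,1\}^{\lfloor \rho n\rfloor}}\Pr[\Psi=\psi]\ \max_{e:\,\mathrm{wt}(e)\le pn}\Pr\big[\hat m(\mathcal C_n(m_0)\oplus e)\ne m_0\ \big|\ \Psi=\psi\big]$$ (terms with $\Pr[\Psi=\psi]=0$ are $0$). A rate $R\in(0,1]$ is achievable if for every $\epsilon>0$ there is an $n_0$ such that for all $n\ge n_0$ there is a code of rate $R$ and blocklength $n$ whose average probability of error is at most $\epsilon$. Let $C(p,\rho,c,s)$ be the supremum of the achievable rates when $F_n=\mathrm{CKT}(\rho,cn^s)$, and $C(p,\rho,\infty,\infty)$ the supremum of the achievable rates when $F_n$ is the set of all functions $\{0,1\}^n\to\{0,1\}^{\lfloor \rho n\rfloor}$. Then $$C(p,r,c,s)=C(p,0,c,s)=C(p,0,\infty,\infty)=1-H(p).$$ -/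

import Mathlib

namespace ObliviousChannel

/-- Binary words of length `n`. -/
abbrev Word (n : ℕ) : Type := Fin n → Bool

/-- Bit-wise XOR. -/
def wordXor {n : ℕ} (x e : Word n) : Word n := fun i => xor (x i) (e i)

/-- The Hamming ball of (real) radius `t` around `z`. -/
def hammingBall {n : ℕ} (t : ℝ) (z : Word n) : Set (Word n) :=
  {z' | (hammingDist z z' : ℝ) ≤ t}

/-- The all-zero word. -/
def zeroWord (n : ℕ) : Word n := fun _ => false

/-- The binary entropy function, in bits. -/
noncomputable def entropy (p : ℝ) : ℝ :=
  -p * Real.logb 2 p - (1 - p) * Real.logb 2 (1 - p)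

/-! ### Boolean circuits -/

/-- A node standing at position `i` of a topological ordering of a circuit with `n` input bits:
either an input node, carrying one of the input bits, or a logic gate computing an arbitrary
Boolean function of two values, which are taken from earlier nodes. -/
inductive Node (n i : ℕ) : Type
  | input (j : Fin n) : Node n i
  | gate (g : Bool → Bool → Bool) (a b : Fin i) : Node n i

/-- A Boolean circuit with `n` input bits and `m` output bits: an acyclic directed graph, listed in
topological order, of input nodes and of gates of in-degree two and unbounded fan-out; `size` is the
total number of nodes, and every output bit is read off at some node. -/
structure BoolCircuit (n m : ℕ) : Type where
  size : ℕ
  node : (i : Fin size) → Node n i.val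
  output : Fin m → Fin size

/-- The bit carried by the `i`-th node on input `x`. -/
def BoolCircuit.value {n m : ℕ} (B : BoolCircuit n m) (x : Word n) (i : Fin B.size) : Bool :=
  match B.node i with
  | Node.input j => x j
  | Node.gate g a b =>
      g (B.value x ⟨a.val, a.isLt.trans i.isLt⟩) (B.value x ⟨b.val, b.isLt.trans i.isLt⟩)
termination_by i.val
decreasing_by
  · exact a.isLt
  · exact b.isLt

/-- The function computed by a circuit. -/
def BoolCircuit.eval {n m : ℕ} (B : BoolCircuit n m) (x : Word n) : Word m :=
  fun k => B.value x (B.output k)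

/-! ### Observation functions -/

/-- The number of bits observed at blocklength `n` and observation rate `r`. -/
noncomputable def obsLength (r : ℝ) (n : ℕ) : ℕ := ⌊r * n⌋₊

/-- Observation functions with `n` input bits and `r n` output bits. -/
abbrev ObsFun (r : ℝ) (n : ℕ) : Type := Word n → Word (obsLength r n)

/-- The observation functions computed by some circuit of size at most `c * n ^ s`, that is, those
whose circuit complexity (the least size of a circuit computing them) is at most `c * n ^ s`. -/
def CKT (r : ℝ) (c s n : ℕ) : Set (ObsFun r n) :=
  {f | ∃ B : BoolCircuit n (obsLength r n), B.size ≤ c * n ^ s ∧ B.eval = f}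

/-! ### Codes and their probability of error -/

/-- The number of messages at blocklength `n` and rate `R`. -/
noncomputable def numMessages (R : ℝ) (n : ℕ) : ℕ := ⌊(2 : ℝ) ^ (R * n)⌋₊

/-- An `(n, R n)` codebook: a deterministic encoder. -/
abbrev Codebook (R : ℝ) (n : ℕ) : Type := Fin (numMessages R n) → Word n

/-- A decoder; `none` is the error symbol. -/
abbrev Decoder (R : ℝ) (n : ℕ) : Type := Word n → Option (Fin (numMessages R n))

/-- The probability of an event under the uniform distribution on `M` messages. -/
noncomputable def prob {M : ℕ} (A : Set (Fin M)) : ℝ := (A.ncard : ℝ) / M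

/-- The conditional probability of `A` given `B` under the uniform distribution on messages. -/
noncomputable def condProb {M : ℕ} (A B : Set (Fin M)) : ℝ := prob (A ∩ B) / prob B

/-- The event that the decoder does not return the transmitted message when the error vector is
`e`. -/
def errorEvent {R : ℝ} {n : ℕ} (C : Codebook R n) (D : Decoder R n) (e : Word n) :
    Set (Fin (numMessages R n)) :=
  {m | D (wordXor (C m) e) ≠ some m}

/-- The event that the adversary observes `ψ` through `f`. -/
def obsEvent {R r : ℝ} {n : ℕ} (C : Codebook R n) (f : ObsFun r n) (ψ : Word (obsLength r n)) :
    Set (Fin (numMessages R n)) :=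
  {m | f (C m) = ψ}

/-- The average probability of error against an adversary who may choose, knowing the code, an
observation function in `F` and then, given the observation, an error vector of weight at most
`p n`: the maximum over `f ∈ F` of the expectation over the observation `ψ` of the maximum over `e`
of the conditional error probability given `ψ`. (Both suprema range over finite sets.) -/
noncomputable def errorProb (p : ℝ) {R r : ℝ} {n : ℕ} (F : Set (ObsFun r n))
    (C : Codebook R n) (D : Decoder R n) : ℝ :=
  ⨆ f : F, ∑ ψ : Word (obsLength r n),
    (⨆ e : hammingBall (p * n) (zeroWord n),
      condProb (errorEvent C D e.val) (obsEvent C f.val ψ)) * prob (obsEvent C f.val ψ)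

/-! ### Capacity -/

/-- `R` is achievable against an adversary with observation rate `r` and error budget `p` who may
use, at blocklength `n`, the observation functions in `F n`. -/
def IsAchievable (p r : ℝ) (F : (n : ℕ) → Set (ObsFun r n)) (R : ℝ) : Prop :=
  ∀ ε : ℝ, 0 < ε → ∃ n₀ : ℕ, ∀ n : ℕ, n₀ ≤ n →
    ∃ (C : Codebook R n) (D : Decoder R n), errorProb p (F n) C D ≤ ε

/-- The supremum of the achievable rates in `(0, 1]`. -/
noncomputable def capacityOf (p r : ℝ) (F : (n : ℕ) → Set (ObsFun r n)) : ℝ :=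
  sSup {R : ℝ | R ∈ Set.Ioc (0 : ℝ) 1 ∧ IsAchievable p r F R}

/-- The capacity `C(p, r, c, s)`: the observation functions are those of circuit complexity at most
`c * n ^ s`. -/
noncomputable def capacity (p r : ℝ) (c s : ℕ) : ℝ :=
  capacityOf p r (fun n => CKT r c s n)

/-- The capacity `C(p, r, ∞, ∞)`: all observation functions are allowed. -/
noncomputable def capacityUnbounded (p r : ℝ) : ℝ :=
  capacityOf p r (fun _ => Set.univ)

end ObliviousChannel

/-!
The capacity of the oblivious channel does not drop when the adversary sees fewer than
`(1 - entropy p) n` bits of a function of the codeword, provided that this function comes from a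
class with only `2 ^ poly(n)` members. Bounded circuits form such a class (`ncard_CKT_le`), and for
`r = 0` the class of all observation functions has a single member.

*Achievability* (`isAchievable_of_ncard_le`). Let `r < R < 1 - entropy p`, take `M ≈ 2 ^ (R n)`
independent uniform codewords, and decode to the unique codeword at distance at most `p n`. Fix an
observation function `f`, a value `ψ` and an error word `e`, and let `A = f ⁻¹' {ψ}`. The error
`e` can only harm a message whose codeword lies in `A` and in the translate by `e` of the ball of
radius `p n` around another codeword. Reveal the codewords one after the other, so that the set
covered by the balls seen so far is independent of the next codeword.
* The number of points of `A` covered by all the balls is a sum of independent variables, each at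
  most the volume `V ≤ 2 ^ (entropy p * n)`, with mean at most `|A| M V / 2 ^ n`, much less than
  `|A|`. The bound on its exponential moment (`sum_two_rpow_coverCount_le`) shows that a small
  fraction of `|A| + 2 ^ ((1 - r) n)` is exceeded with doubly exponentially small probability; this
  is where `r < 1 - entropy p` enters.
* If few points are covered, each new codeword is hit with small conditional probability, and the
  number of hits has a bounded exponential moment as well (`sum_two_rpow_hitCount_le`). The number of
  hits exceeds a small multiple of `M (|A| / 2 ^ n + 2 ^ (-r n))` with doubly exponentially small
  probability, because `r < R`.

Revealing the codewords in the opposite order accounts for the other half of the pairs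
(`collisionCount_le`). The union bound over all triples `(f, ψ, e)` then yields a code that is good
for all of them at once (`exists_forall_collisionCount_le`), and summation over the at most
`2 ^ (r n)` values `ψ` bounds the probability of error.

*Converse* (`le_of_isAchievable`). An adversary may ignore the observation and add a word of the
ball of radius `p n`. Since a received word determines the decoded message, at most `2 ^ n` pairs of
a message and an error word are decoded correctly, whereas a rate above `1 - entropy p` produces
exponentially more pairs, by the lower bound `eventually_two_rpow_le_ballVolume`.
-/

namespace ObliviousChannel

open Finset

/-! ### Concentration for random codes -/

section Concentration

variable {W : Type*} [DecidableEq W]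

/-- The number of points of `A`, with multiplicity, that the sets `S (C m)` attached to the codewords
cover. -/
def coverCount (S : W → Finset W) (A : Finset W) {M : ℕ} (C : Fin M → W) : ℕ :=
  ∑ m, #(A ∩ S (C m))

/-- The number of codewords in `A` that lie in the set `S (C m')` attached to some codeword with a
larger index. Restricting to larger indices makes the codewords independent of the sets that hit
them. -/
def hitCount (S : W → Finset W) (A : Finset W) {M : ℕ} (C : Fin M → W) : ℕ :=
  ∑ m, if C m ∈ A ∧ ∃ m', m < m' ∧ C m ∈ S (C m') then 1 else 0

theorem coverCount_cons (S : W → Finset W) (A : Finset W) {M : ℕ} (w : W) (C : Fin M → W) :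
    coverCount S A (Fin.cons w C : Fin (M + 1) → W) = #(A ∩ S w) + coverCount S A C := by
  simp [coverCount, Fin.sum_univ_succ]

theorem hitCount_cons (S : W → Finset W) (A : Finset W) {M : ℕ} (w : W) (C : Fin M → W) :
    hitCount S A (Fin.cons w C : Fin (M + 1) → W) =
      (if w ∈ A ∧ ∃ m', w ∈ S (C m') then 1 else 0) + hitCount S A C := by
  unfold hitCount
  rw [Fin.sum_univ_succ]
  simp only [Fin.exists_fin_succ, Fin.cons_zero, Fin.cons_succ, Fin.succ_lt_succ_iff, Fin.succ_pos,
    lt_self_iff_false, Fin.not_lt_zero, false_and, true_and, false_or]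

/-- The number of codewords in `A` that lie in the set attached to some other codeword. -/
def collisionCount (S : W → Finset W) (A : Finset W) {M : ℕ} (C : Fin M → W) : ℕ :=
  #{m | C m ∈ A ∧ ∃ m', m' ≠ m ∧ C m ∈ S (C m')}

theorem collisionCount_le (S : W → Finset W) (A : Finset W) {M : ℕ} (C : Fin M → W) :
    collisionCount S A C ≤ hitCount S A C + hitCount S A (C ∘ Fin.rev) := by
  have h : hitCount S A (C ∘ Fin.rev) =
      ∑ m, if C m ∈ A ∧ ∃ m', m' < m ∧ C m ∈ S (C m') then 1 else 0 := by
    unfold hitCount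
    rw [← Equiv.sum_comp Fin.revPerm]
    refine sum_congr rfl fun m _ => ?_
    congr 1
    simp only [Function.comp_apply, Fin.revPerm_apply, Fin.rev_rev, eq_iff_iff]
    refine and_congr_right fun _ => ⟨?_, ?_⟩
    · rintro ⟨m', h, h'⟩
      exact ⟨m'.rev, by rwa [Fin.rev_lt_iff], h'⟩
    · rintro ⟨m', h, h'⟩
      exact ⟨m'.rev, by rwa [Fin.rev_lt_rev], by rwa [Fin.rev_rev]⟩
  rw [h]
  unfold hitCount collisionCount
  rw [← Finset.card_filter, ← Finset.card_filter]
  refine le_trans (card_le_card ?_) (card_union_le _ _)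
  intro m
  simp only [mem_filter, mem_union, mem_univ, true_and]
  rintro ⟨h1, m', h2, h3⟩
  rcases lt_or_gt_of_ne h2 with h | h
  · exact Or.inr ⟨h1, m', h, h3⟩
  · exact Or.inl ⟨h1, m', h, h3⟩

variable [Fintype W]

theorem sum_two_rpow_coverCount_le (S : W → Finset W) (A : Finset W) (M : ℕ) {V : ℝ} (hV : 0 < V)
    (hS : ∀ u, (#(S u) : ℝ) ≤ V) (hS' : ∀ w, (#{u | w ∈ S u} : ℝ) ≤ V) :
    ∑ C : Fin M → W, (2 : ℝ) ^ ((coverCount S A C : ℝ) / V) ≤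
      ((Fintype.card W : ℝ) + #A) ^ M := by
  have h1 (C : Fin M → W) : (2 : ℝ) ^ ((coverCount S A C : ℝ) / V) =
      ∏ m, (2 : ℝ) ^ ((#(A ∩ S (C m)) : ℝ) / V) := by
    rw [← Real.rpow_sum_of_pos two_pos, coverCount, Nat.cast_sum, Finset.sum_div]
  have h2 (u : W) : (2 : ℝ) ^ ((#(A ∩ S u) : ℝ) / V) ≤ 1 + (#(A ∩ S u) : ℝ) / V := by
    have hle : (#(A ∩ S u) : ℝ) / V ≤ 1 := by
      rw [div_le_one hV]
      exact le_trans (by exact_mod_cast card_le_card inter_subset_right) (hS u)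
    have := rpow_one_add_le_one_add_mul_self (s := 1) (by norm_num)
      (p := (#(A ∩ S u) : ℝ) / V) (by positivity) hle
    norm_num at this
    exact this
  -- double counting: each point of `A` lies in at most `V` of the sets `S u`
  have h3 : ∑ u, (#(A ∩ S u) : ℝ) ≤ #A * V := by
    have : ∑ u, (#(A ∩ S u) : ℝ) = ∑ w ∈ A, (#{u | w ∈ S u} : ℝ) := by
      have := Finset.sum_card_bipartiteAbove_eq_sum_card_bipartiteBelow (s := A)
        (t := (univ : Finset W)) (fun w u => w ∈ S u)
      simp only [bipartiteAbove, bipartiteBelow] at this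
      simp only [← Finset.filter_mem_eq_inter]
      exact_mod_cast this.symm
    rw [this, ← nsmul_eq_mul]
    exact sum_le_card_nsmul _ _ _ fun w _ => hS' w
  simp_rw [h1]
  rw [← Fintype.sum_pow (fun u => (2 : ℝ) ^ ((#(A ∩ S u) : ℝ) / V)) M]
  refine pow_le_pow_left₀ (by positivity) ?_ _
  calc ∑ u, (2 : ℝ) ^ ((#(A ∩ S u) : ℝ) / V)
      ≤ ∑ u, (1 + (#(A ∩ S u) : ℝ) / V) := sum_le_sum fun u _ => h2 u
    _ = Fintype.card W + (∑ u, (#(A ∩ S u) : ℝ)) / V := by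
        rw [sum_add_distrib, Finset.sum_div]; simp
    _ ≤ Fintype.card W + #A := by
        gcongr
        rwa [div_le_iff₀ hV]

theorem card_hit_le_coverCount (S : W → Finset W) (A : Finset W) {M : ℕ} (C : Fin M → W) :
    #{w | w ∈ A ∧ ∃ m', w ∈ S (C m')} ≤ coverCount S A C := by
  have : ({w | w ∈ A ∧ ∃ m', w ∈ S (C m')} : Finset W) ⊆ univ.biUnion fun m => A ∩ S (C m) := by
    intro w; simp
  exact (card_le_card this).trans card_biUnion_le

/-- The exponential moment of the number of hits, on the event that at most `K` points of `A` are
covered. The codewords are revealed from the last to the first; each new one is hit with conditional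
probability at most `K / |W|`. -/
theorem sum_two_rpow_hitCount_le (S : W → Finset W) (A : Finset W) (M : ℕ) {K : ℝ} (hK : 0 ≤ K) :
    ∑ C : Fin M → W with (coverCount S A C : ℝ) ≤ K, (2 : ℝ) ^ hitCount S A C ≤
      ((Fintype.card W : ℝ) + K) ^ M := by
  induction M with
  | zero =>
    refine (sum_le_sum_of_subset_of_nonneg (filter_subset _ _)
      (fun _ _ _ => by positivity)).trans ?_
    simp [hitCount]
  | succ M ih =>
    rw [Finset.sum_filter, ← (Fin.consEquiv fun _ : Fin (M + 1) => W).sum_comp,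
      Fintype.sum_prod_type_right, pow_succ]
    refine le_trans ?_ (mul_le_mul_of_nonneg_right ih (by positivity))
    rw [Finset.sum_filter, Finset.sum_mul]
    refine sum_le_sum fun C _ => ?_
    simp only [Fin.consEquiv, Equiv.coe_fn_mk, coverCount_cons, hitCount_cons]
    by_cases hC : (coverCount S A C : ℝ) ≤ K
    · rw [if_pos hC]
      calc _ ≤ ∑ w : W, (2 : ℝ) ^ hitCount S A C *
            (1 + if w ∈ A ∧ ∃ m', w ∈ S (C m') then (1 : ℝ) else 0) := by
            refine sum_le_sum fun w _ => ?_
            split_ifs <;> first | positivity | (rw [pow_add]; norm_num; linarith) | norm_num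
        _ = (2 : ℝ) ^ hitCount S A C * (Fintype.card W + #{w | w ∈ A ∧ ∃ m', w ∈ S (C m')}) := by
            rw [← mul_sum, sum_add_distrib, Finset.sum_boole]; simp
        _ ≤ _ := by
            gcongr
            exact le_trans (by exact_mod_cast card_hit_le_coverCount S A C) hC
    · rw [if_neg hC, zero_mul]
      refine (sum_eq_zero fun w _ => if_neg fun h => hC (le_trans ?_ h)).le
      push_cast
      exact le_add_of_nonneg_left (Nat.cast_nonneg _)

/-- Markov's inequality for `2 ^ hitCount` and for `2 ^ (coverCount / V)`. -/
theorem card_lt_hitCount_le (S : W → Finset W) (A : Finset W) (M : ℕ) {V K : ℝ} (hV : 0 < V)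
    (hS : ∀ u, (#(S u) : ℝ) ≤ V) (hS' : ∀ w, (#{u | w ∈ S u} : ℝ) ≤ V) (hK : 0 ≤ K) (t : ℝ) :
    (#{C : Fin M → W | t < hitCount S A C} : ℝ) ≤
      (2 : ℝ) ^ (-(K / V)) * ((Fintype.card W : ℝ) + #A) ^ M +
        (2 : ℝ) ^ (-t) * ((Fintype.card W : ℝ) + K) ^ M := by
  have h1 : (#{C : Fin M → W | K < coverCount S A C} : ℝ) ≤
      (2 : ℝ) ^ (-(K / V)) * ((Fintype.card W : ℝ) + #A) ^ M := by
    rw [Real.rpow_neg two_pos.le, ← div_eq_inv_mul, le_div_iff₀ (by positivity), ← nsmul_eq_mul]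
    refine le_trans (card_nsmul_le_sum _ (fun C => (2 : ℝ) ^ ((coverCount S A C : ℝ) / V)) _ ?_)
      (le_trans (sum_le_sum_of_subset_of_nonneg (filter_subset _ _) fun _ _ _ => by positivity)
        (sum_two_rpow_coverCount_le S A M hV hS hS'))
    intro C hC
    rw [mem_filter] at hC
    exact Real.rpow_le_rpow_of_exponent_le one_le_two (by have := hC.2.le; gcongr)
  have h2 : (#{C : Fin M → W | (coverCount S A C : ℝ) ≤ K ∧ t < hitCount S A C} : ℝ) ≤
      (2 : ℝ) ^ (-t) * ((Fintype.card W : ℝ) + K) ^ M := by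
    rw [Real.rpow_neg two_pos.le, ← div_eq_inv_mul, le_div_iff₀ (by positivity), ← nsmul_eq_mul]
    refine le_trans (card_nsmul_le_sum _ (fun C => (2 : ℝ) ^ hitCount S A C) _ ?_)
      (le_trans (sum_le_sum_of_subset_of_nonneg ?_ fun _ _ _ => by positivity)
        (sum_two_rpow_hitCount_le S A M hK))
    · intro C hC
      rw [mem_filter] at hC
      rw [← Real.rpow_natCast]
      exact Real.rpow_le_rpow_of_exponent_le one_le_two hC.2.2.le
    · intro C
      simp +contextual
  refine le_trans ?_ (add_le_add h1 h2)
  rw [← Nat.cast_add, Nat.cast_le]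
  refine le_trans (card_le_card ?_) (card_union_le _ _)
  intro C
  simp only [mem_filter, mem_union, mem_univ, true_and]
  intro h
  by_cases hC : (coverCount S A C : ℝ) ≤ K
  · exact Or.inr ⟨hC, h⟩
  · exact Or.inl (not_le.1 hC)

theorem add_pow_le_mul_two_rpow {Q x : ℝ} (hQ : 0 < Q) (hx : 0 ≤ x) (M : ℕ) :
    (Q + x) ^ M ≤ Q ^ M * (2 : ℝ) ^ (2 * (x * M / Q)) := by
  have h1 : 1 + x / Q ≤ (2 : ℝ) ^ (2 * (x / Q)) := by
    rw [Real.rpow_def_of_pos two_pos]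
    have h := Real.add_one_le_exp (x / Q)
    have hl := Real.log_two_gt_d9
    have hq : 0 ≤ x / Q := by positivity
    refine le_trans (by linarith) (Real.exp_le_exp.2 (?_ : x / Q ≤ _))
    nlinarith
  have h2 : Q + x = Q * (1 + x / Q) := by field_simp
  have h3 : (2 : ℝ) ^ (2 * (x * M / Q)) = ((2 : ℝ) ^ (2 * (x / Q))) ^ M := by
    rw [← Real.rpow_mul_natCast two_pos.le]; congr 1; ring
  rw [h2, mul_pow, h3]
  gcongr

/-- All but a fraction `2 * 2 ^ (-L)` of the codes have few hits, compared with the proportion of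
`A`, where `b` is a floor for the size of the sets `A` that are taken into account. -/
theorem card_lt_hitCount_le_mul (S : W → Finset W) (A : Finset W) (M : ℕ) {V b η L : ℝ}
    (hW : 0 < Fintype.card W) (hV : 0 < V) (hb : 0 ≤ b) (hη : 0 < η)
    (hS : ∀ u, (#(S u) : ℝ) ≤ V) (hS' : ∀ w, (#{u | w ∈ S u} : ℝ) ≤ V)
    (hMV : M * V / Fintype.card W ≤ η / 4) (hL : L ≤ η * b / (2 * V))
    (hL' : L ≤ η * b * M / Fintype.card W) :
    (#{C : Fin M → W | 3 * (η * (#A + b) * M / Fintype.card W) < hitCount S A C} : ℝ) ≤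
      2 * (2 : ℝ) ^ (-L) * (Fintype.card W : ℝ) ^ M := by
  set Q : ℝ := (Fintype.card W : ℝ)
  have hQ : 0 < Q := Nat.cast_pos.2 hW
  have hA : (0 : ℝ) ≤ #A := Nat.cast_nonneg _
  have hM : (0 : ℝ) ≤ M := Nat.cast_nonneg _
  set K : ℝ := η * (#A + b) with hKdef
  have hK : 0 ≤ K := by positivity
  refine (card_lt_hitCount_le S A M hV hS hS' hK _).trans ?_
  have e1 : (2 : ℝ) ^ (-(K / V)) * (Q + #A) ^ M ≤ (2 : ℝ) ^ (-L) * Q ^ M := by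
    refine (mul_le_mul_of_nonneg_left (add_pow_le_mul_two_rpow hQ hA M)
      (by positivity)).trans ?_
    rw [mul_left_comm, ← Real.rpow_add two_pos, mul_comm (Q ^ M)]
    gcongr
    · norm_num
    have h1 : #A * M / Q ≤ η * #A / (4 * V) := by
      have : #A * M / Q = (#A / V) * (M * V / Q) := by field_simp
      rw [this]
      refine (mul_le_mul_of_nonneg_left hMV (by positivity)).trans (le_of_eq ?_)
      field_simp
    have h2 : K / V = 4 * (η * #A / (4 * V)) + 2 * (η * b / (2 * V)) := by
      rw [hKdef]; field_simp
    have h3 : 0 ≤ η * #A / (4 * V) := by positivity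
    have h4 : 0 ≤ η * b / (2 * V) := by positivity
    linarith
  have e2 : (2 : ℝ) ^ (-(3 * (K * M / Q))) * (Q + K) ^ M ≤ (2 : ℝ) ^ (-L) * Q ^ M := by
    refine (mul_le_mul_of_nonneg_left (add_pow_le_mul_two_rpow hQ hK M)
      (by positivity)).trans ?_
    rw [mul_left_comm, ← Real.rpow_add two_pos, mul_comm (Q ^ M)]
    gcongr
    · norm_num
    have h1 : η * b * M / Q ≤ K * M / Q := by
      rw [hKdef]; gcongr; linarith
    linarith
  linarith

/-- A family of fewer than `2 ^ L / 4` requirements can be met by a single code. -/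
theorem exists_forall_collisionCount_le {ι : Type*} [Fintype ι] (S : ι → W → Finset W)
    (A : ι → Finset W) (M : ℕ) {V b η L : ℝ}
    (hW : 0 < Fintype.card W) (hV : 0 < V) (hb : 0 ≤ b) (hη : 0 < η)
    (hS : ∀ i u, (#(S i u) : ℝ) ≤ V) (hS' : ∀ i w, (#{u | w ∈ S i u} : ℝ) ≤ V)
    (hMV : M * V / Fintype.card W ≤ η / 4) (hL : L ≤ η * b / (2 * V))
    (hL' : L ≤ η * b * M / Fintype.card W) (hι : 4 * (Fintype.card ι : ℝ) < 2 ^ L) :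
    ∃ C : Fin M → W, ∀ i, (collisionCount (S i) (A i) C : ℝ) ≤
      6 * (η * (#(A i) + b) * M / Fintype.card W) := by
  by_contra! hcon
  set t : ι → ℝ := fun i => 3 * (η * (#(A i) + b) * M / Fintype.card W) with ht
  let B : ι → Finset (Fin M → W) := fun i => {C | t i < hitCount (S i) (A i) C}
  let B' : ι → Finset (Fin M → W) := fun i => {C | t i < hitCount (S i) (A i) (C ∘ Fin.rev)}
  have hB' (i : ι) : #(B' i) = #(B i) := by
    refine card_equiv ((Fin.revPerm (n := M)).arrowCongr (Equiv.refl W)) fun C => ?_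
    simp only [B, B', mem_filter, mem_univ, true_and]
    rfl
  have hB (i : ι) : (#(B i) : ℝ) ≤ 2 * (2 : ℝ) ^ (-L) * (Fintype.card W : ℝ) ^ M :=
    card_lt_hitCount_le_mul (S i) (A i) M hW hV hb hη (hS i) (hS' i) hMV hL hL'
  have hcover : (univ : Finset (Fin M → W)) ⊆ univ.biUnion fun i => B i ∪ B' i := by
    intro C _
    obtain ⟨i, hi⟩ := hcon C
    simp only [mem_biUnion, mem_univ, true_and, mem_union, mem_filter, B, B']
    refine ⟨i, ?_⟩
    by_contra! h
    have := collisionCount_le (S i) (A i) C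
    have : (collisionCount (S i) (A i) C : ℝ) ≤
      hitCount (S i) (A i) C + hitCount (S i) (A i) (C ∘ Fin.rev) := by exact_mod_cast this
    have h1 := h.1
    have h2 := h.2
    simp only [ht] at h1 h2
    linarith
  have h1 : ((Fintype.card W : ℝ)) ^ M ≤ ∑ _i : ι, 4 * (2 : ℝ) ^ (-L) * (Fintype.card W : ℝ) ^ M := by
    calc ((Fintype.card W : ℝ)) ^ M = (#(univ : Finset (Fin M → W)) : ℝ) := by simp
      _ ≤ ((∑ i, #(B i ∪ B' i) : ℕ) : ℝ) := by
          exact_mod_cast (card_le_card hcover).trans card_biUnion_le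
      _ ≤ _ := by
          push_cast
          refine sum_le_sum fun i _ => ?_
          have h : (#(B i ∪ B' i) : ℝ) ≤ #(B i) + #(B' i) := by exact_mod_cast card_union_le _ _
          rw [hB' i] at h
          linarith [hB i]
  have hQ : (0 : ℝ) < (Fintype.card W : ℝ) ^ M := by positivity
  rw [sum_const, card_univ, nsmul_eq_mul, ← mul_assoc, Real.rpow_neg two_pos.le] at h1
  have h2 := le_of_mul_le_mul_right ((one_mul _).trans_le h1) hQ
  rw [← mul_assoc, ← div_eq_mul_inv, le_div_iff₀ (by positivity)] at h2
  linarith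

end Concentration

/-! ### The volume of Hamming balls -/

/-- The number of binary words of length `n` and Hamming weight at most `t`. -/
noncomputable def ballVolume (n : ℕ) (t : ℝ) : ℕ :=
  #{w : Word n | (hammingDist (zeroWord n) w : ℝ) ≤ t}

theorem hammingDist_eq_zeroWord_wordXor {n : ℕ} (u v : Word n) :
    hammingDist u v = hammingDist (zeroWord n) (wordXor u v) := by
  unfold hammingDist
  congr 1
  ext i
  simp only [mem_filter, mem_univ, true_and, zeroWord, wordXor]
  cases hu : u i <;> cases hv : v i <;> simp [hu, hv]

theorem wordXor_comm {n : ℕ} (u v : Word n) : wordXor u v = wordXor v u := by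
  funext i; exact Bool.xor_comm _ _

theorem wordXor_wordXor_cancel {n : ℕ} (u v : Word n) : wordXor u (wordXor u v) = v := by
  funext i; simp [wordXor]

/-- The sets of words that the error word `e` moves into a ball around `u`. -/
noncomputable def shiftedBall {n : ℕ} (t : ℝ) (e u : Word n) : Finset (Word n) :=
  {w | (hammingDist u (wordXor w e) : ℝ) ≤ t}

theorem mem_shiftedBall {n : ℕ} {t : ℝ} {e u w : Word n} :
    w ∈ shiftedBall t e u ↔ (hammingDist u (wordXor w e) : ℝ) ≤ t := by
  simp [shiftedBall]

theorem card_shiftedBall {n : ℕ} (t : ℝ) (e u : Word n) :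
    #(shiftedBall t e u) = ballVolume n t := by
  refine card_bij' (fun w _ => wordXor u (wordXor w e)) (fun w _ => wordXor e (wordXor u w))
    ?_ ?_ ?_ ?_
  · intro w hw
    rw [mem_shiftedBall, hammingDist_eq_zeroWord_wordXor] at hw
    simpa using hw
  · intro w hw
    rw [mem_shiftedBall, hammingDist_eq_zeroWord_wordXor, wordXor_comm _ e,
      wordXor_wordXor_cancel, wordXor_wordXor_cancel]
    simpa using hw
  · intro w _
    rw [wordXor_wordXor_cancel, wordXor_comm w, wordXor_wordXor_cancel]
  · intro w _
    rw [wordXor_comm _ e, wordXor_wordXor_cancel, wordXor_wordXor_cancel]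

theorem card_mem_shiftedBall {n : ℕ} (t : ℝ) (e w : Word n) :
    #{u | w ∈ shiftedBall t e u} = ballVolume n t := by
  rw [← card_shiftedBall t (zeroWord n) (wordXor w e)]
  congr 1
  ext u
  have h : wordXor u (zeroWord n) = u := by funext i; simp [wordXor, zeroWord]
  simp [mem_shiftedBall, h, hammingDist_comm]

theorem two_rpow_entropy_mul (q x : ℝ) :
    (2 : ℝ) ^ (entropy q * x) = Real.exp (Real.binEntropy q * x) := by
  rw [Real.rpow_def_of_pos two_pos]
  congr 1
  have : Real.log 2 ≠ 0 := (Real.log_pos one_lt_two).ne'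
  simp only [entropy, Real.binEntropy, Real.logb, Real.log_inv]
  field_simp
  ring

theorem ballVolume_le {p : ℝ} (hp : 0 < p) (hp' : p < 1 / 2) (n : ℕ) :
    (ballVolume n (p * n) : ℝ) ≤ 2 ^ (entropy p * n) := by
  have hq : 0 < 1 - p := by linarith
  -- the product Bernoulli measure has total mass one
  have hsum : ∑ w : Word n, ∏ i, (if w i then p else 1 - p) = 1 := by
    rw [← Fintype.sum_pow (fun b : Bool => if b then p else 1 - p) n]
    simp
  have hprod (w : Word n) : ∏ i, (if w i then p else 1 - p) =
      p ^ hammingDist (zeroWord n) w * (1 - p) ^ (n - hammingDist (zeroWord n) w) := by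
    have h1 : hammingDist (zeroWord n) w = #{i | w i = true} := by
      unfold hammingDist; congr 1; ext i; simp [zeroWord]
    have h2 : n - #{i | w i = true} = #{i | ¬ w i = true} := by
      have := card_filter_add_card_filter_not (s := (univ : Finset (Fin n)))
        (fun i => w i = true)
      simp only [card_univ, Fintype.card_fin] at this
      omega
    rw [prod_ite, prod_const, prod_const, h1, h2]
  have hmass (w : Word n) (hw : (hammingDist (zeroWord n) w : ℝ) ≤ p * n) :
      ((2 : ℝ) ^ (entropy p * n))⁻¹ ≤ ∏ i, (if w i then p else 1 - p) := by
    have hk : hammingDist (zeroWord n) w ≤ n := by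
      simpa using hammingDist_le_card_fintype (x := zeroWord n) (y := w)
    rw [hprod, two_rpow_entropy_mul, ← Real.exp_neg]
    -- since `p < 1 - p`, the words of weight exactly `p * n` have the least mass in the ball
    set k := hammingDist (zeroWord n) w
    rw [← Real.exp_log (show 0 < p ^ k * (1 - p) ^ (n - k) by positivity)]
    refine Real.exp_le_exp.2 ?_
    rw [Real.log_mul (by positivity) (by positivity), Real.log_pow, Real.log_pow, Nat.cast_sub hk,
      Real.binEntropy, Real.log_inv, Real.log_inv]
    have hlog : Real.log p ≤ Real.log (1 - p) := Real.log_le_log hp (by linarith)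
    nlinarith [mul_nonneg (sub_nonneg.2 hw) (sub_nonneg.2 hlog)]
  have h := card_nsmul_le_sum {w : Word n | (hammingDist (zeroWord n) w : ℝ) ≤ p * n}
    (fun w => ∏ i, (if w i then p else 1 - p)) _
    (fun w hw => hmass w (by simpa using hw))
  have h' := h.trans (sum_le_sum_of_subset_of_nonneg (filter_subset _ _) fun w _ _ =>
    prod_nonneg fun i _ => by split_ifs <;> positivity)
  rw [hsum, nsmul_eq_mul, ← div_eq_mul_inv, div_le_one (by positivity)] at h'
  exact h'

theorem choose_le_ballVolume {n k : ℕ} {t : ℝ} (h : (k : ℝ) ≤ t) :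
    n.choose k ≤ ballVolume n t := by
  have hc : #(powersetCard k (univ : Finset (Fin n))) = n.choose k := by simp
  rw [← hc]
  refine card_le_card_of_injOn (fun s i => decide (i ∈ s)) ?_ ?_
  · intro s hs
    have hs' : #s = k := by simpa using hs
    have : hammingDist (zeroWord n) (fun i => decide (i ∈ s)) = k := by
      rw [← hs']; unfold hammingDist; congr 1; ext i; simp [zeroWord]
    simpa [this] using h
  · intro s _ s' _ hss
    ext i
    simpa using congrFun hss i

/-- The binomial distribution with parameters `k + l` and `k / (k + l)` has its mode at `k`; this is
the comparison with the terms above the mode. -/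
theorem choose_mul_pow_le_of_le (k l : ℕ) {j : ℕ} (hj : k ≤ j) (hj' : j ≤ k + l) :
    (k + l).choose j * k ^ j * l ^ (k + l - j) ≤ (k + l).choose k * k ^ k * l ^ l := by
  induction j, hj using Nat.le_induction with
  | base => simp
  | succ j hkj ih =>
    refine le_trans ?_ (ih (by omega))
    obtain ⟨d, rfl⟩ : ∃ d, l = (j - k) + (d + 1) := ⟨k + l - (j + 1), by omega⟩
    obtain ⟨i, rfl⟩ : ∃ i, j = k + i := ⟨j - k, by omega⟩
    have e0 : k + i - k = i := by omega
    rw [e0]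
    have e1 : k + (i + (d + 1)) - (k + i + 1) = d := by omega
    have e2 : k + (i + (d + 1)) - (k + i) = d + 1 := by omega
    rw [e1, e2]
    have hch := Nat.choose_succ_right_eq (k + (i + (d + 1))) (k + i)
    rw [e2] at hch
    refine Nat.le_of_mul_le_mul_right (c := k + i + 1) ?_ (by omega)
    set N := (k + (i + (d + 1))).choose (k + i)
    set N' := (k + (i + (d + 1))).choose (k + i + 1)
    set x := i + (d + 1)
    calc N' * k ^ (k + i + 1) * x ^ d * (k + i + 1)
        = (N' * (k + i + 1)) * k ^ (k + i) * x ^ d * k := by ring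
      _ = N * k ^ (k + i) * x ^ d * ((d + 1) * k) := by rw [hch]; ring
      _ ≤ N * k ^ (k + i) * x ^ d * (x * (k + i + 1)) :=
          Nat.mul_le_mul_left _ (Nat.mul_le_mul (by omega) (by omega))
      _ = _ := by ring

theorem choose_mul_pow_le (k l : ℕ) {j : ℕ} (hj : j ≤ k + l) :
    (k + l).choose j * k ^ j * l ^ (k + l - j) ≤ (k + l).choose k * k ^ k * l ^ l := by
  rcases le_total k j with h | h
  · exact choose_mul_pow_le_of_le k l h hj
  · have h1 := choose_mul_pow_le_of_le l k (j := k + l - j) (by omega) (by omega)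
    have e1 : l + k - (k + l - j) = j := by omega
    rw [e1, add_comm l k, Nat.choose_symm hj, mul_right_comm] at h1
    refine h1.trans (le_of_eq ?_)
    have := Nat.choose_symm_add (a := k) (b := l)
    rw [this]; ring

/-- The mode of a binomial distribution on `n + 1` points has probability at least `1 / (n + 1)`. -/
theorem exp_binEntropy_mul_le {n k : ℕ} (hk : 0 < k) (hkn : k < n) :
    Real.exp (Real.binEntropy (k / n) * n) ≤ (n + 1) * n.choose k := by
  obtain ⟨l, rfl⟩ : ∃ l, n = k + l := ⟨n - k, by omega⟩
  have hl : 0 < l := by omega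
  have h : (k + l) ^ (k + l) ≤ (k + l + 1) * ((k + l).choose k * k ^ k * l ^ l) := by
    rw [add_pow]
    refine (sum_le_card_nsmul _ _ ((k + l).choose k * k ^ k * l ^ l) fun j hj => ?_).trans ?_
    · have := choose_mul_pow_le k l (j := j) (by simpa [Nat.lt_succ_iff] using hj)
      refine le_trans (le_of_eq ?_) this
      simp only [Nat.cast_id]
      ring
    · simp
  have hR : ((k : ℝ) + l) ^ (k + l) ≤ (k + l + 1) * ((k + l).choose k * k ^ k * l ^ l) := by
    exact_mod_cast h
  have hk' : (0 : ℝ) < k := by exact_mod_cast hk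
  have hl' : (0 : ℝ) < l := by exact_mod_cast hl
  have hexp : Real.exp (Real.binEntropy (k / (k + l : ℕ)) * (k + l : ℕ)) =
      ((k : ℝ) + l) ^ (k + l) / (k ^ k * l ^ l) := by
    rw [← Real.exp_log (show 0 < ((k : ℝ) + l) ^ (k + l) / (k ^ k * l ^ l) by positivity)]
    congr 1
    rw [Real.log_div (by positivity) (by positivity), Real.log_mul (by positivity) (by positivity),
      Real.log_pow, Real.log_pow, Real.log_pow, Real.binEntropy]
    have e : (1 : ℝ) - k / (k + l : ℕ) = l / (k + l : ℕ) := by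
      push_cast; field_simp; ring
    rw [e, inv_div, inv_div, Real.log_div (by positivity) (by positivity),
      Real.log_div (by positivity) (by positivity)]
    push_cast
    field_simp
    ring
  rw [hexp, div_le_iff₀ (by positivity)]
  push_cast
  linarith

open Filter Topology in
theorem eventually_two_rpow_le_ballVolume {p : ℝ} (hp : 0 < p) (hp' : p < 1 / 2) {η : ℝ}
    (hη : 0 < η) :
    ∀ᶠ n : ℕ in atTop, (2 : ℝ) ^ ((entropy p - η) * n) ≤ (n + 1) * ballVolume n (p * n) := by
  have hlim : Tendsto (fun n : ℕ => (⌊p * n⌋₊ : ℝ) / n) atTop (𝓝 p) :=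
    (tendsto_nat_floor_mul_div_atTop hp.le).comp tendsto_natCast_atTop_atTop
  have hent := (Real.binEntropy_continuous.tendsto p).comp hlim
  have hlt : Real.binEntropy p - η * Real.log 2 < Real.binEntropy p := by
    have := mul_pos hη (Real.log_pos one_lt_two); linarith
  filter_upwards [hent.eventually (lt_mem_nhds hlt), hlim.eventually (lt_mem_nhds hp),
    hlim.eventually (gt_mem_nhds (show p < 1 by linarith)), eventually_gt_atTop 0]
    with n h1 h2 h3 hn
  have hn' : (0 : ℝ) < n := by exact_mod_cast hn
  have hk : 0 < ⌊p * n⌋₊ := by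
    by_contra! h
    simp [Nat.le_zero.1 h] at h2
  have hkn : ⌊p * n⌋₊ < n := by
    rw [div_lt_one hn'] at h3; exact_mod_cast h3
  have hle := exp_binEntropy_mul_le hk hkn
  have hch : (n.choose ⌊p * n⌋₊ : ℝ) ≤ ballVolume n (p * n) := by
    exact_mod_cast choose_le_ballVolume (Nat.floor_le (by positivity))
  calc (2 : ℝ) ^ ((entropy p - η) * n)
      = Real.exp ((Real.binEntropy p - η * Real.log 2) * n) := by
        rw [sub_mul, Real.rpow_sub two_pos, two_rpow_entropy_mul, Real.rpow_def_of_pos two_pos,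
          ← Real.exp_sub]
        congr 1; ring
    _ ≤ Real.exp (Real.binEntropy (⌊p * n⌋₊ / n) * n) := by
        refine Real.exp_le_exp.2 ?_
        gcongr
        exact h1.le
    _ ≤ _ := hle.trans (by gcongr)

theorem entropy_pos {p : ℝ} (hp : 0 < p) (hp' : p < 1 / 2) : 0 < entropy p := by
  have h := two_rpow_entropy_mul p 1
  have h2 := Real.exp_lt_exp.2 (Real.binEntropy_pos hp (by linarith))
  rw [mul_one, mul_one] at h
  rw [← h, Real.exp_zero] at h2
  by_contra! hge
  have := Real.rpow_le_rpow_of_exponent_le one_le_two hge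
  rw [Real.rpow_zero] at this
  linarith

/-! ### Counting circuits -/

/-- A node is either an input position or a binary Boolean function with a pair of arguments. -/
def nodeEquiv (n i : ℕ) : Node n i ≃ Fin n ⊕ (Bool → Bool → Bool) × Fin i × Fin i where
  toFun
    | .input j => .inl j
    | .gate g a b => .inr (g, a, b)
  invFun
    | .inl j => .input j
    | .inr (g, a, b) => .gate g a b
  left_inv x := by cases x <;> rfl
  right_inv x := by rcases x with j | ⟨g, a, b⟩ <;> rfl

instance (n i : ℕ) : Fintype (Node n i) := Fintype.ofEquiv _ (nodeEquiv n i).symm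

theorem card_node (n i : ℕ) : Fintype.card (Node n i) = n + 16 * (i * i) := by
  rw [Fintype.card_congr (nodeEquiv n i)]
  simp

/-- Each of the at most `S` nodes has at most `n + 16 * S ^ 2` possible values, and each of the `m`
outputs is read off at one of at most `S` nodes. -/
theorem ncard_circuits_le (n m S : ℕ) :
    {f : Word n → Word m | ∃ B : BoolCircuit n m, B.size ≤ S ∧ B.eval = f}.ncard ≤
      (S + 1) * ((n + 16 * (S * S)) ^ S * S ^ m) := by
  let Φ : (Σ k : Fin (S + 1), ((i : Fin k.val) → Node n i.val) × (Fin m → Fin k.val)) →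
      (Word n → Word m) := fun x => (BoolCircuit.mk x.1.val x.2.1 x.2.2).eval
  have hsub : {f : Word n → Word m | ∃ B : BoolCircuit n m, B.size ≤ S ∧ B.eval = f} ⊆
      Set.range Φ := by
    rintro f ⟨B, hB, rfl⟩
    exact ⟨⟨⟨B.size, by omega⟩, B.node, B.output⟩, rfl⟩
  refine (Set.ncard_le_ncard hsub (Set.toFinite _)).trans ?_
  rw [← Set.image_univ]
  refine (Set.ncard_image_le (Set.toFinite _)).trans ?_
  rw [Set.ncard_univ, Nat.card_eq_fintype_card, Fintype.card_sigma]
  refine (sum_le_card_nsmul _ _ ((n + 16 * (S * S)) ^ S * S ^ m) fun k _ => ?_).trans (by simp)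
  have hk : k.val ≤ S := by omega
  rw [Fintype.card_prod, Fintype.card_pi]
  refine Nat.mul_le_mul ?_ (by simpa using Nat.pow_le_pow_left hk m)
  calc ∏ i : Fin k.val, Fintype.card (Node n i) ≤ ∏ _i : Fin k.val, (n + 16 * (S * S)) := by
        refine prod_le_prod' fun i _ => ?_
        rw [card_node]
        have : i.val ≤ S := by omega
        gcongr
    _ = (n + 16 * (S * S)) ^ k.val := by simp
    _ ≤ _ := by
        rcases S.eq_zero_or_pos with rfl | hS
        · rw [Nat.le_zero.1 hk]
        · exact Nat.pow_le_pow_right (by positivity) hk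

theorem obsLength_le {r : ℝ} (hr : r ≤ 1) (n : ℕ) : obsLength r n ≤ n :=
  Nat.floor_le_of_le (mul_le_of_le_one_left (Nat.cast_nonneg n) hr)

theorem ncard_CKT_le {r : ℝ} (hr : r ≤ 1) {c s : ℕ} (hc : 1 ≤ c) (hs : 1 ≤ s) (n : ℕ) :
    (CKT r c s n).ncard ≤ 2 ^ (19 * c ^ 3 * n ^ (s * 3)) := by
  set S := c * n ^ s with hS
  have hnS : n ≤ S := by
    calc n ≤ n ^ s := Nat.le_self_pow (by omega) n
      _ ≤ S := Nat.le_mul_of_pos_left _ (by omega)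
  have hmS : obsLength r n ≤ S := (obsLength_le hr n).trans hnS
  have h1 : S ≤ S ^ 3 := Nat.le_self_pow (by norm_num) S
  have h2 : S ^ 2 ≤ S ^ 3 := by
    rcases S.eq_zero_or_pos with h | h
    · simp [h]
    · exact Nat.pow_le_pow_right h (by norm_num)
  -- crude bounds by `x ≤ 2 ^ x` suffice, as the exponent only has to be polynomial in `n`
  have h3 : n + 16 * (S * S) ≤ 2 ^ (17 * S ^ 2) := by
    refine le_trans ?_ (Nat.lt_two_pow_self).le
    nlinarith [Nat.le_self_pow (show 2 ≠ 0 by norm_num) S]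
  have h4 : S ^ obsLength r n ≤ 2 ^ (S ^ 2) := by
    calc S ^ obsLength r n ≤ (2 ^ S) ^ obsLength r n :=
          Nat.pow_le_pow_left (Nat.lt_two_pow_self).le _
      _ ≤ (2 ^ S) ^ S := Nat.pow_le_pow_right (by positivity) hmS
      _ = 2 ^ (S ^ 2) := by rw [← pow_mul, sq]
  calc (CKT r c s n).ncard
      ≤ (S + 1) * ((n + 16 * (S * S)) ^ S * S ^ obsLength r n) := ncard_circuits_le _ _ _
    _ ≤ 2 ^ S * ((2 ^ (17 * S ^ 2)) ^ S * 2 ^ (S ^ 2)) := by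
        gcongr
        exact Nat.lt_two_pow_self
    _ = 2 ^ (S + (17 * S ^ 3 + S ^ 2)) := by ring
    _ ≤ 2 ^ (19 * S ^ 3) := Nat.pow_le_pow_right two_pos (by omega)
    _ = _ := by rw [hS]; congr 1; ring

/-! ### Bounds for the probability of error -/

section ErrorProb

variable {p R r : ℝ} {n : ℕ} {F : Set (ObsFun r n)} {C : Codebook R n} {D : Decoder R n}

theorem prob_nonneg {M : ℕ} (A : Set (Fin M)) : 0 ≤ prob A := by
  unfold prob; positivity

theorem prob_mono {M : ℕ} {A B : Set (Fin M)} (h : A ⊆ B) : prob A ≤ prob B := by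
  unfold prob
  have := Set.ncard_le_ncard h (Set.toFinite _)
  gcongr

theorem condProb_mul_prob {M : ℕ} (A B : Set (Fin M)) : condProb A B * prob B = prob (A ∩ B) := by
  unfold condProb
  rcases eq_or_ne (prob B) 0 with h | h
  · rw [h, mul_zero]
    exact le_antisymm (prob_nonneg _) (h ▸ prob_mono Set.inter_subset_right)
  · exact div_mul_cancel₀ _ h

theorem zeroWord_mem_hammingBall {t : ℝ} (ht : 0 ≤ t) : zeroWord n ∈ hammingBall t (zeroWord n) := by
  simpa [hammingBall] using ht

theorem errorProb_le (hp : 0 ≤ p) {ε : ℝ} (hε : 0 ≤ ε)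
    (X : ObsFun r n → Word (obsLength r n) → ℝ)
    (hX : ∀ f ∈ F, ∀ ψ, ∀ e ∈ hammingBall (p * n) (zeroWord n),
      prob (errorEvent C D e ∩ obsEvent C f ψ) ≤ X f ψ)
    (hsum : ∀ f ∈ F, ∑ ψ, X f ψ ≤ ε) : errorProb p F C D ≤ ε := by
  refine Real.iSup_le (fun f => ?_) hε
  refine (sum_le_sum fun ψ _ => ?_).trans (hsum f.1 f.2)
  have hz := zeroWord_mem_hammingBall (n := n) (t := p * n) (by positivity)
  have : Nonempty (hammingBall (p * n) (zeroWord n)) := ⟨⟨_, hz⟩⟩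
  rcases (prob_nonneg (obsEvent C f.1 ψ)).eq_or_lt with h | h
  · rw [← h, mul_zero]
    exact (prob_nonneg _).trans (hX f.1 f.2 ψ _ hz)
  · rw [← le_div_iff₀ h]
    refine ciSup_le fun e => ?_
    rw [le_div_iff₀ h, condProb_mul_prob]
    exact hX f.1 f.2 ψ e.1 e.2

theorem sum_prob_inter_obsEvent (f : ObsFun r n) (E : Set (Fin (numMessages R n))) :
    ∑ ψ, prob (E ∩ obsEvent C f ψ) = prob E := by
  classical
  simp only [prob, ← Finset.sum_div]
  congr 1
  rw [Set.ncard_eq_toFinset_card' E, card_eq_sum_card_fiberwise (f := fun m => f (C m)) (t := univ)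
    (fun _ _ => by simp), Nat.cast_sum]
  refine sum_congr rfl fun ψ _ => ?_
  rw [Set.ncard_eq_toFinset_card']
  congr 2
  ext m
  rw [Set.mem_toFinset, mem_filter, Set.mem_toFinset]
  rfl

/-- An adversary may always ignore the observation. -/
theorem prob_errorEvent_le_errorProb {f : ObsFun r n} (hf : f ∈ F) {e : Word n}
    (he : e ∈ hammingBall (p * n) (zeroWord n)) : prob (errorEvent C D e) ≤ errorProb p F C D := by
  rw [← sum_prob_inter_obsEvent f]
  refine le_trans (sum_le_sum fun ψ _ => ?_)
    (le_ciSup (Set.toFinite (Set.range fun f : F => ∑ ψ : Word (obsLength r n),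
      (⨆ e : hammingBall (p * n) (zeroWord n),
        condProb (errorEvent C D e.val) (obsEvent C f.val ψ)) *
          prob (obsEvent C f.val ψ))).bddAbove ⟨f, hf⟩)
  rw [← condProb_mul_prob]
  refine mul_le_mul_of_nonneg_right ?_ (prob_nonneg _)
  exact le_ciSup (f := fun e : hammingBall (p * n) (zeroWord n) =>
    condProb (errorEvent C D e.val) (obsEvent C f ψ)) (Set.toFinite _).bddAbove ⟨e, he⟩

end ErrorProb

theorem numMessages_le (R : ℝ) (n : ℕ) : (numMessages R n : ℝ) ≤ 2 ^ (R * n) :=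
  Nat.floor_le (by positivity)

theorem le_two_mul_numMessages {R : ℝ} (hR : 0 ≤ R) (n : ℕ) :
    (2 : ℝ) ^ (R * n) ≤ 2 * numMessages R n := by
  have h1 : (1 : ℝ) ≤ 2 ^ (R * n) := Real.one_le_rpow one_le_two (by positivity)
  have h2 : (1 : ℝ) ≤ numMessages R n := by exact_mod_cast Nat.one_le_floor_iff _ |>.2 h1
  have h3 : (2 : ℝ) ^ (R * n) < numMessages R n + 1 := Nat.lt_floor_add_one _
  linarith

/-! ### Achievability -/

open Classical in
/-- The decoder that returns the only message whose codeword is at distance at most `t` from the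
received word, if there is exactly one. -/
noncomputable def uniqueDecoder {R : ℝ} {n : ℕ} (C : Codebook R n) (t : ℝ) : Decoder R n :=
  fun y => if h : ∃! m, (hammingDist (C m) y : ℝ) ≤ t then some h.choose else none

theorem ncard_errorEvent_inter_le {R r t : ℝ} {n : ℕ} (C : Codebook R n) (f : ObsFun r n)
    (ψ : Word (obsLength r n)) {e : Word n} (he : e ∈ hammingBall t (zeroWord n)) :
    (errorEvent C (uniqueDecoder C t) e ∩ obsEvent C f ψ).ncard ≤
      collisionCount (shiftedBall t e) {w | f w = ψ} C := by
  rw [collisionCount, ← Set.ncard_coe_finset]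
  refine Set.ncard_le_ncard ?_ (Set.toFinite _)
  rintro m ⟨hm, hψ⟩
  simp only [coe_filter, mem_univ, true_and, Set.mem_ofPred_eq, mem_filter]
  refine ⟨hψ, ?_⟩
  by_contra! hcon
  refine hm ?_
  have h1 : (hammingDist (C m) (wordXor (C m) e) : ℝ) ≤ t := by
    rw [hammingDist_eq_zeroWord_wordXor, wordXor_wordXor_cancel]; exact he
  have h2 : ∃! m', (hammingDist (C m') (wordXor (C m) e) : ℝ) ≤ t := by
    refine ⟨m, h1, fun m' hm' => ?_⟩
    by_contra hne
    exact hcon m' hne (mem_shiftedBall.2 hm')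
  rw [uniqueDecoder, dif_pos h2, h2.unique h2.choose_spec.1 h1]

open Filter Topology in
theorem eventually_poly_lt_two_rpow (c k : ℕ) {a γ : ℝ} (ha : 0 < a) (hγ : 0 < γ) :
    ∀ᶠ n : ℕ in atTop, (c : ℝ) * n ^ k < a * 2 ^ (γ * n) := by
  have h1 : (1 : ℝ) < 2 ^ γ := Real.one_lt_rpow one_lt_two hγ
  have h := (tendsto_pow_const_div_const_pow_of_one_lt k h1).const_mul (c : ℝ)
  rw [mul_zero] at h
  filter_upwards [h.eventually (gt_mem_nhds ha)] with n hn
  rw [Real.rpow_mul two_pos.le, Real.rpow_natCast]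
  rwa [← mul_div_assoc, div_lt_iff₀ (by positivity)] at hn

/-- Random codes achieve every rate in `(r, 1 - entropy p)` against a class of observation functions
of at most exponential size in a polynomial. -/
theorem isAchievable_of_ncard_le {p r R : ℝ} {F : (n : ℕ) → Set (ObsFun r n)} (hp : 0 < p)
    (hp' : p < 1 / 2) (hr : 0 ≤ r) (hrR : r < R) (hR : R < 1 - entropy p) (c k : ℕ)
    (hF : ∀ n, (F n).ncard ≤ 2 ^ (c * n ^ k)) : IsAchievable p r F R := by
  intro ε hε
  -- 6 collisions per unit of `η`, and the terms `|A|` and `b` contribute equally when summed over `ψ`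
  set η : ℝ := ε / 12 with hη_def
  have hη : 0 < η := by positivity
  have hH := entropy_pos hp hp'
  rw [← Filter.eventually_atTop]
  filter_upwards [eventually_poly_lt_two_rpow 1 0 (a := η / 4) (γ := 1 - entropy p - R)
      (by positivity) (by linarith),
    eventually_poly_lt_two_rpow (c + 4) (k + 1) (a := η / 2) (γ := R - r)
      (by positivity) (by linarith), Filter.eventually_ge_atTop 1] with n h1 h2 hn
  set m := obsLength r n
  have hmr : (m : ℝ) ≤ r * n := Nat.floor_le (by positivity)
  have hmn : m ≤ n := obsLength_le (by linarith) n
  set M := numMessages R n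
  set V : ℝ := 2 ^ (entropy p * n) with hV
  -- an average fibre of the observation function has at least `b` elements
  set b : ℝ := 2 ^ ((1 - r) * n) with hb
  set L : ℝ := η / 2 * 2 ^ ((R - r) * n) with hL
  have hcardW : Fintype.card (Word n) = 2 ^ n := by simp
  have hQ : (Fintype.card (Word n) : ℝ) = 2 ^ (1 * (n : ℝ)) := by
    rw [hcardW, one_mul, Real.rpow_natCast]; push_cast; rfl
  have hvol : (ballVolume n (p * n) : ℝ) ≤ V := ballVolume_le hp hp' n
  have hVpos : 0 < V := by positivity
  have hbpos : 0 < b := by positivity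
  have hML := le_two_mul_numMessages (hr.trans hrR.le) n
  have hMU := numMessages_le R n
  have hMpos : (0 : ℝ) < M := by
    have : (0 : ℝ) < 2 ^ (R * n) := by positivity
    linarith
  have hMV : M * V / Fintype.card (Word n) ≤ η / 4 := by
    have h1' : (1 : ℝ) ≤ η / 4 * 2 ^ ((1 - entropy p - R) * n) := by
      simpa using h1.le
    rw [hQ, div_le_iff₀ (by positivity)]
    have e : (2 : ℝ) ^ (1 * (n : ℝ)) =
        2 ^ (R * n) * V * 2 ^ ((1 - entropy p - R) * n) := by
      rw [hV, ← Real.rpow_add two_pos, ← Real.rpow_add two_pos]; congr 1; ring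
    rw [e]
    calc M * V ≤ 2 ^ (R * n) * V * 1 := by rw [mul_one]; gcongr
      _ ≤ 2 ^ (R * n) * V * (η / 4 * 2 ^ ((1 - entropy p - R) * n)) := by gcongr
      _ = _ := by ring
  have hL1 : L ≤ η * b / (2 * V) := by
    have e : b = V * 2 ^ ((1 - r - entropy p) * n) := by
      rw [hb, hV, ← Real.rpow_add two_pos]; congr 1; ring
    rw [e, hL, show η * (V * (2 : ℝ) ^ ((1 - r - entropy p) * n)) / (2 * V) =
      η / 2 * 2 ^ ((1 - r - entropy p) * n) by field_simp]
    exact mul_le_mul_of_nonneg_left (Real.rpow_le_rpow_of_exponent_le one_le_two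
      (mul_le_mul_of_nonneg_right (by linarith) (Nat.cast_nonneg n))) (by positivity)
  have hL2 : L ≤ η * b * M / Fintype.card (Word n) := by
    have e : b = (2 : ℝ) ^ (1 * (n : ℝ)) * 2 ^ (-r * n) := by
      rw [hb, ← Real.rpow_add two_pos]; congr 1; ring
    have e' : (2 : ℝ) ^ ((R - r) * n) = 2 ^ (R * n) * 2 ^ (-r * n) := by
      rw [← Real.rpow_add two_pos]; congr 1; ring
    rw [hQ, e, hL, e', show η * ((2 : ℝ) ^ (1 * (n : ℝ)) * 2 ^ (-r * n)) * M / 2 ^ (1 * (n : ℝ)) =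
      η / 2 * (2 * M * 2 ^ (-r * n)) by field_simp]
    gcongr
  have : Fintype (F n) := Fintype.ofFinite _
  have hι : 4 * (Fintype.card (F n × Word m × Word n) : ℝ) < 2 ^ L := by
    have hcard : Fintype.card (F n × Word m × Word n) ≤ 2 ^ (c * n ^ k + m + n) := by
      rw [Fintype.card_prod, Fintype.card_prod, hcardW, ← Nat.card_eq_fintype_card (α := F n),
        Nat.card_coe_set_eq, pow_add, pow_add, mul_assoc]
      simpa using Nat.mul_le_mul_right (2 ^ m * 2 ^ n) (hF n)
    calc 4 * (Fintype.card (F n × Word m × Word n) : ℝ)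
        ≤ 4 * 2 ^ (c * n ^ k + m + n) := by gcongr; exact_mod_cast hcard
      _ = (2 : ℝ) ^ ((2 + (c * n ^ k + m + n) : ℕ) : ℝ) := by
          rw [Real.rpow_natCast, pow_add 2 2]; norm_num
      _ < 2 ^ L := by
          refine Real.rpow_lt_rpow_of_exponent_lt one_lt_two (lt_of_le_of_lt ?_ h2)
          have hpow : n ≤ n ^ (k + 1) := Nat.le_self_pow (by omega) n
          have hpow' : n ^ k ≤ n ^ (k + 1) := Nat.pow_le_pow_right hn (by omega)
          have : 2 + (c * n ^ k + m + n) ≤ (c + 4) * n ^ (k + 1) := by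
            nlinarith [Nat.mul_le_mul_left c hpow']
          exact_mod_cast this
  obtain ⟨C, hC⟩ := exists_forall_collisionCount_le
    (S := fun i : F n × Word m × Word n => shiftedBall (p * n) i.2.2)
    (A := fun i => {w | i.1.1 w = i.2.1}) M (V := V) (b := b) (η := η) (L := L)
    (by rw [hcardW]; positivity) hVpos hbpos.le hη
    (fun i u => by rw [card_shiftedBall]; exact hvol)
    (fun i w => by rw [card_mem_shiftedBall]; exact hvol) hMV hL1 hL2 hι
  refine ⟨C, uniqueDecoder C (p * n), errorProb_le hp.le hε.le
    (fun f ψ => 6 * η * ((#{w | f w = ψ} : ℝ) + b) / Fintype.card (Word n)) ?_ ?_⟩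
  · intro f hf ψ e he
    rw [prob, div_le_iff₀ hMpos]
    have h := hC (⟨f, hf⟩, ψ, e)
    have h' : ((errorEvent C (uniqueDecoder C (p * n)) e ∩ obsEvent C f ψ).ncard : ℝ) ≤
        collisionCount (shiftedBall (p * n) e) {w | f w = ψ} C := by
      exact_mod_cast ncard_errorEvent_inter_le C f ψ he
    refine h'.trans (h.trans (le_of_eq ?_))
    ring
  · intro f _
    have hfib : ∑ ψ, (#{w | f w = ψ} : ℝ) = Fintype.card (Word n) := by
      have := card_eq_sum_card_fiberwise (f := f) (s := univ) (t := univ) (fun _ _ => by simp)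
      rw [← card_univ, this]; push_cast; rfl
    rw [← Finset.sum_div, ← mul_sum, sum_add_distrib, hfib, sum_const, card_univ, nsmul_eq_mul]
    have hmb : (Fintype.card (Word m) : ℝ) * b ≤ Fintype.card (Word n) := by
      have e : (Fintype.card (Word m) : ℝ) = 2 ^ (m : ℝ) := by
        rw [Real.rpow_natCast]; simp
      rw [e, hQ, hb, ← Real.rpow_add two_pos]
      refine Real.rpow_le_rpow_of_exponent_le one_le_two ?_
      linarith
    rw [div_le_iff₀ (by rw [hQ]; positivity)]
    have : ε = 12 * η := by rw [hη_def]; ring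
    rw [this]
    nlinarith

/-! ### The converse -/

/-- A received word determines the decoded message, and with it the error word, so that at most
`2 ^ n` pairs of a message and an error word are decoded correctly. -/
theorem sum_card_decoded_le {R : ℝ} {n : ℕ} (C : Codebook R n) (D : Decoder R n)
    (B : Finset (Word n)) :
    ∑ e ∈ B, #{m | D (wordXor (C m) e) = some m} ≤ 2 ^ n := by
  have hcard : #(univ : Finset (Word n)) = 2 ^ n := by simp
  rw [← card_sigma, ← hcard]
  refine card_le_card_of_injOn (fun x => wordXor (C x.2) x.1) (fun _ _ => by simp) ?_
  rintro ⟨e, m⟩ h ⟨e', m'⟩ h' heq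
  simp only [coe_sigma, Set.mem_sigma_iff, mem_coe, mem_filter, mem_univ, true_and] at h h' heq
  have hm : m = m' := by
    have := h.2
    rw [heq, h'.2] at this
    exact (Option.some.inj this).symm
  subst hm
  have he : e = e' := by
    rw [← wordXor_wordXor_cancel (C m) e, heq, wordXor_wordXor_cancel]
  rw [he]

theorem numMessages_mul_ballVolume_le {p R r : ℝ} {n : ℕ} {F : Set (ObsFun r n)}
    (hF : F.Nonempty) (C : Codebook R n) (D : Decoder R n) (hM : 0 < numMessages R n)
    (h : errorProb p F C D ≤ 1 / 2) :
    (numMessages R n : ℝ) * ballVolume n (p * n) ≤ 2 * 2 ^ n := by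
  obtain ⟨f, hf⟩ := hF
  have hM' : (0 : ℝ) < numMessages R n := by exact_mod_cast hM
  set B : Finset (Word n) := {w | (hammingDist (zeroWord n) w : ℝ) ≤ p * n}
  have hlow (e : Word n) (he : e ∈ B) :
      (numMessages R n : ℝ) / 2 ≤ #{m | D (wordXor (C m) e) = some m} := by
    have he' : e ∈ hammingBall (p * n) (zeroWord n) := by simpa [B, hammingBall] using he
    have h1 := (prob_errorEvent_le_errorProb (C := C) (D := D) hf he').trans h
    have h2 : (errorEvent C D e).ncard = #{m | ¬ D (wordXor (C m) e) = some m} := by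
      rw [← Set.ncard_coe_finset]; congr 1; ext m; simp [errorEvent]
    have h3 := card_filter_add_card_filter_not (s := (univ : Finset (Fin (numMessages R n))))
      (fun m => D (wordXor (C m) e) = some m)
    rw [card_univ, Fintype.card_fin, ← h2] at h3
    have h4 : (#{m | D (wordXor (C m) e) = some m} : ℝ) + (errorEvent C D e).ncard =
      numMessages R n := by exact_mod_cast h3
    rw [prob, div_le_iff₀ hM'] at h1
    linarith
  have h1 := (card_nsmul_le_sum B _ _ hlow).trans
    (by exact_mod_cast sum_card_decoded_le C D B : _ ≤ (2 : ℝ) ^ n)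
  rw [nsmul_eq_mul] at h1
  have h2 : (ballVolume n (p * n) : ℝ) = #B := rfl
  rw [h2]
  linarith

open Filter Topology in
theorem le_of_isAchievable {p r R : ℝ} {F : (n : ℕ) → Set (ObsFun r n)} (hp : 0 < p)
    (hp' : p < 1 / 2) (hR : 0 ≤ R) (hF : ∀ᶠ n in atTop, (F n).Nonempty)
    (h : IsAchievable p r F R) : R ≤ 1 - entropy p := by
  by_contra! hlt
  set η : ℝ := (R - (1 - entropy p)) / 2 with hη_def
  have hη : 0 < η := by rw [hη_def]; linarith
  obtain ⟨n₀, h₀⟩ := h (1 / 2) (by norm_num)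
  -- `8 * n` bounds the factor `4 * (n + 1)` lost in the estimates for `V` and `M`
  obtain ⟨n, hn₀, hFn, hvol, hpoly, hn⟩ := ((eventually_ge_atTop n₀).and (hF.and
    ((eventually_two_rpow_le_ballVolume hp hp' hη).and
      ((eventually_poly_lt_two_rpow 8 1 one_pos hη).and (eventually_ge_atTop 1))))).exists
  obtain ⟨C, D, hCD⟩ := h₀ n hn₀
  have hML := le_two_mul_numMessages hR n
  have hpos : (0 : ℝ) < 2 ^ (R * n) := by positivity
  have hM : 0 < numMessages R n := by
    have : (0 : ℝ) < numMessages R n := by linarith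
    exact_mod_cast this
  have hle := numMessages_mul_ballVolume_le hFn C D hM hCD
  have hn' : (1 : ℝ) ≤ n := by exact_mod_cast hn
  have key : (2 : ℝ) ^ n * 2 ^ (η * n) ≤ 2 ^ n * (4 * (n + 1)) := by
    calc (2 : ℝ) ^ n * 2 ^ (η * n) = 2 ^ (R * n) * 2 ^ ((entropy p - η) * n) := by
          rw [← Real.rpow_natCast, ← Real.rpow_add two_pos, ← Real.rpow_add two_pos]
          congr 1; rw [hη_def]; ring
      _ ≤ (2 * numMessages R n) * ((n + 1) * ballVolume n (p * n)) := by gcongr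
      _ = 2 * (n + 1) * (numMessages R n * ballVolume n (p * n)) := by ring
      _ ≤ 2 * (n + 1) * (2 * 2 ^ n) := by gcongr
      _ = _ := by ring
  have := le_of_mul_le_mul_left key (by positivity)
  push_cast at hpoly
  linarith

/-! ### Capacity -/

/-- The capacity of a class of observation functions that is nonempty and of at most exponential
size in a polynomial. -/
theorem capacityOf_eq {p r : ℝ} {F : (n : ℕ) → Set (ObsFun r n)} (hp : 0 < p) (hp' : p < 1 / 2)
    (hr : 0 ≤ r) (hr' : r < 1 - entropy p) (c k : ℕ)
    (hF : ∀ n, (F n).ncard ≤ 2 ^ (c * n ^ k)) (hne : ∀ᶠ n in Filter.atTop, (F n).Nonempty) :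
    capacityOf p r F = 1 - entropy p := by
  have hH := entropy_pos hp hp'
  have hmem (R : ℝ) (h : r < R) (h' : R < 1 - entropy p) :
      R ∈ {R : ℝ | R ∈ Set.Ioc (0 : ℝ) 1 ∧ IsAchievable p r F R} :=
    ⟨⟨by linarith, by linarith⟩, isAchievable_of_ncard_le hp hp' hr h h' c k hF⟩
  refine csSup_eq_of_forall_le_of_forall_lt_exists_gt ?_ ?_ ?_
  · obtain ⟨R, h, h'⟩ := exists_between hr'
    exact ⟨R, hmem R h h'⟩
  · rintro R ⟨hR, h⟩
    exact le_of_isAchievable hp hp' hR.1.le hne h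
  · intro w hw
    obtain ⟨R, h, h'⟩ := exists_between (max_lt hw hr')
    exact ⟨R, hmem R ((le_max_right _ _).trans_lt h) h', (le_max_left _ _).trans_lt h⟩

theorem CKT_nonempty (r : ℝ) {c : ℕ} (hc : 1 ≤ c) (s : ℕ) {n : ℕ} (hn : 0 < n) :
    (CKT r c s n).Nonempty :=
  ⟨_, ⟨1, fun _ => .input ⟨0, hn⟩, fun _ => 0⟩, Nat.mul_pos hc (Nat.pow_pos hn), rfl⟩

theorem ncard_obsFun_zero_le_one {n : ℕ} (F : Set (ObsFun 0 n)) : F.ncard ≤ 1 := by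
  have h0 : obsLength 0 n = 0 := by simp [obsLength]
  have : Subsingleton (ObsFun 0 n) := by
    refine ⟨fun f g => ?_⟩
    funext w i
    exact absurd i.isLt (by omega)
  exact Set.ncard_le_one_of_subsingleton F

end ObliviousChannel

open ObliviousChannel in
theorem theorem1 (p r : ℝ) (c s : ℕ) (hp : 0 < p) (hp' : p < 1 / 2)
    (hr : 0 ≤ r) (hr' : r < 1 - ObliviousChannel.entropy p) (hc : 1 ≤ c) (hs : 1 ≤ s) :
    ObliviousChannel.capacity p r c s = ObliviousChannel.capacity p 0 c s ∧
    ObliviousChannel.capacity p 0 c s = ObliviousChannel.capacityUnbounded p 0 ∧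
    ObliviousChannel.capacityUnbounded p 0 = 1 - ObliviousChannel.entropy p := by
  have hH := entropy_pos hp hp'
  have hckt (ρ : ℝ) (hρ : 0 ≤ ρ) (hρ' : ρ < 1 - entropy p) :
      capacity p ρ c s = 1 - entropy p :=
    capacityOf_eq hp hp' hρ hρ' (19 * c ^ 3) (s * 3)
      (fun n => ncard_CKT_le (by linarith) hc hs n)
      ((Filter.eventually_gt_atTop 0).mono fun _ => CKT_nonempty ρ hc s)
  have huniv : capacityUnbounded p 0 = 1 - entropy p :=
    capacityOf_eq hp hp' le_rfl (hr.trans_lt hr') 0 0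
      (fun n => by simpa using ncard_obsFun_zero_le_one Set.univ)
      (Filter.Eventually.of_forall fun _ => Set.univ_nonempty)
  rw [hckt r hr hr', hckt 0 le_rfl (hr.trans_lt hr'), huniv]
  exact ⟨rfl, rfl, rfl⟩
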